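/- Let $1\le N\le N_R$ be integers (in the application $N=N_R-N_T+1$ with $1\le N_T\le N_R$). Put $A_n(\sigma)=\frac{(N)_n}{(N_R)_n}\frac{\sigma^n}{n!}$, where $(x)_n=x(x+1)\cdots(x+n-1)$, and ${}_1F_1(N;N_R;\sigma)=\sum_{n\ge0}A_n(\sigma)$. Let $$M(s,a)=\frac{1}{(1-s)^N}\,{}_1F_1\!\Big(N;N_R;\frac{as}{1-s}\Big)\quad(s<1),\qquad p(t,a)=\sum_{n=0}^\infty A_n(a)\sum_{m=0}^n\binom nm\frac{(-1)^m t^{N+n-m-1}e^{-t}}{(N+n-m-1)!}.$$ For every $a\ge 0$, $p(\cdot,a)$ is non-negative and $C^\infty$ on $(0,\infty)$, and it is the density, supported on $(0,\infty)$, of the unique probability law on $\mathbb R$ whose moment generating function is $M(s,a)$ for $s<1$. Write $p^{(l)}=\partial_t^l p$ and $\mathbf p=(p,p^{(1)},p^{(2)})^{T}$. Then for all $t>0$ and $a>0$, $\mathbf p(t,\cdot)$ is differentiable at $a$ and $$\partial_a\mathbf p(t,a)=\frac1a\,\mathbf Q(t,a)\,\mathbf p(t,a),$$ where the $3\times3$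 matrix $\mathbf Q(t,a)$ has first row $(-1,\;N-t-2,\;-t)$ and remaining entries \begin{align*} Q_{21}&=2-N_R+\frac{2-2N-N_R-a+NN_R+Na}{t},\\ Q_{22}&=4-2N-N_R-a+t+\frac{2+N^2-3N}{t},\\ Q_{23}&=1-N+t,\\ Q_{31}&=-2+N_R+\frac{-4+4N+2N_R+a-2NN_R-Na}{t}\\ &\quad+\frac{-4+6N+2N_R+2a-3NN_R-3Na+N^2N_R+N^2a-2N^2}{t^2},\\ Q_{32}&=3N-4+a-t+\frac{-6-3N^2+9N}{t}+\frac{-4+8N-5N^2+N^3}{t^2},\\ Q_{33}&=-1+2N-N_R-a-t+\frac{-2-N^2+3N}{t}. \end{align*} In particular $a\,\partial_a p=-p+(N-t-2)\,p^{(1)}-t\,p^{(2)}$; moreover $a\,\partial_a p^{(1)}=-t\,p^{(3)}+(N-t-3)\,p^{(2)}-2\,p^{(1)}$. -/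

import Mathlib

open MeasureTheory ProbabilityTheory Set
open scoped Nat ContDiff Matrix

noncomputable section

namespace ZFSnr

/-- The coefficient `A_n(σ) = (N)_n / (N_R)_n * σ^n / n!`, with `(x)_n` the rising factorial. -/
def coeffA (N NR n : ℕ) (σ : ℝ) : ℝ :=
  (N.ascFactorial n : ℝ) / (NR.ascFactorial n : ℝ) * (σ ^ n / (n ! : ℝ))

/-- The confluent hypergeometric function `₁F₁(N; N_R; σ)`. -/
def hyp1F1 (N NR : ℕ) (σ : ℝ) : ℝ := ∑' n : ℕ, coeffA N NR n σ

/-- The (normalized) SNR moment generating function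
`M(s, a) = (1 - s)^(-N) * ₁F₁(N; N_R; a s / (1 - s))`, meant for `s < 1`. -/
def snrMgf (N NR : ℕ) (s a : ℝ) : ℝ :=
  1 / (1 - s) ^ N * hyp1F1 N NR (a * s / (1 - s))

/-- The (normalized) SNR density `p(t, a)`, as an infinite series. For `1 ≤ N` and `m ≤ n` the
exponent `N + n - m - 1` involves no truncated subtraction. -/
def snrPdf (N NR : ℕ) (t a : ℝ) : ℝ :=
  ∑' n : ℕ, coeffA N NR n a *
    ∑ m ∈ Finset.range (n + 1), (n.choose m : ℝ) *
      ((-1) ^ m * t ^ (N + n - m - 1) * Real.exp (-t) / ((N + n - m - 1)! : ℝ))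

/-- The measure on `ℝ` with density `t ↦ p(t, a)` on `(0, ∞)`. -/
def snrMeasure (N NR : ℕ) (a : ℝ) : Measure ℝ :=
  (volume.restrict (Ioi 0)).withDensity fun t => ENNReal.ofReal (snrPdf N NR t a)

/-- `ν` is a probability law on `ℝ` with moment generating function `M(·, a)` on `s < 1`. -/
def HasSnrMgf (N NR : ℕ) (a : ℝ) (ν : Measure ℝ) : Prop :=
  IsProbabilityMeasure ν ∧
    ∀ s : ℝ, s < 1 → Integrable (fun x => Real.exp (s * x)) ν ∧ mgf id ν s = snrMgf N NR s a

/-- `p^{(l)}(t, a)`, the `l`-th partial derivative of `p` with respect to `t`. -/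
def snrPdfDeriv (N NR l : ℕ) (t a : ℝ) : ℝ :=
  iteratedDeriv l (fun τ => snrPdf N NR τ a) t

/-- The vector `(p, p^{(1)}, p^{(2)})` at `(t, a)`. -/
def snrVec (N NR : ℕ) (t a : ℝ) : Fin 3 → ℝ :=
  ![snrPdf N NR t a, snrPdfDeriv N NR 1 t a, snrPdfDeriv N NR 2 t a]

/-- The matrix `Q(t, a)`; the parameters `N` and `R = N_R` are taken in `ℝ`. -/
def matQ (N R t a : ℝ) : Matrix (Fin 3) (Fin 3) ℝ :=
  !![-1, N - t - 2, -t;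
     2 - R + (2 - 2 * N - R - a + N * R + N * a) / t,
     4 - 2 * N - R - a + t + (2 + N ^ 2 - 3 * N) / t,
     1 - N + t;
     -2 + R + (-4 + 4 * N + 2 * R + a - 2 * N * R - N * a) / t
       + (-4 + 6 * N + 2 * R + 2 * a - 3 * N * R - 3 * N * a) / t ^ 2
       + (N ^ 2 * R + N ^ 2 * a - 2 * N ^ 2) / t ^ 2,
     3 * N - 4 + a - t + (-6 - 3 * N ^ 2 + 9 * N) / t
       + (-4 + 8 * N - 5 * N ^ 2 + N ^ 3) / t ^ 2,
     -1 + 2 * N - R - a - t + (-2 - N ^ 2 + 3 * N) / t]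

end ZFSnr

end

/-!
Let `e_k` be the Erlang density of shape `k` and `Δ` the forward difference in `k`. Then
`p(·, a) = ₁F₁(N; N_R; a Δ) e_N`. Since `∂ₜ e_k = e_{k-1} - e_k` and `t e_k = k e_{k+1}`, each of
`∂ₜ`, multiplication by `t` and `a ∂ₐ` acts on such series through the coefficients and the shape
`k`. The hypergeometric recurrence of the coefficients at the shapes `N` and `N + 1`, together with
the formula for `a ∂ₐ p`, is a linear system for `a ∂ₐ (p, ∂ₜ p, ∂ₜ² p)`, whose solution is `Q`.

Positivity: the sequence `(N)_n / (N_R)_n` is completely monotone, so the coefficients of `e^a p` as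
a power series in `a` are combinations of Erlang densities with non-negative weights.

The Laplace transform of `Δⁿ e_k` is `(1 - s)^{-k} (s / (1 - s))ⁿ`; summing gives `M(s, a)`, and a
law whose moment generating function is finite near `0` is determined by it.
-/

noncomputable section

namespace ZFSnr

section EntireSeq

/-- The coefficient sequences of the power series that converge on all of `ℝ`. -/
def IsEntireSeq (c : ℕ → ℝ) : Prop :=
  ∀ r : ℝ, Summable fun n => c n * r ^ n

/-- The coefficients of the derivative of the power series with coefficients `c`. -/
def derivSeq (c : ℕ → ℝ) (n : ℕ) : ℝ :=
  (n + 1) * c (n + 1)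

/-- The coefficients of the image of the power series with coefficients `c` under `x d/dx`. -/
def eulerSeq (c : ℕ → ℝ) (n : ℕ) : ℝ :=
  n * c n

variable {c d u : ℕ → ℝ}

theorem isEntireSeq_of_abs_le {C : ℝ} (hc : ∀ n, |c n| ≤ C ^ n / (n ! : ℝ)) : IsEntireSeq c := by
  intro r
  refine .of_norm_bounded (Real.summable_pow_div_factorial (C * |r|)) fun n => ?_
  rw [Real.norm_eq_abs, abs_mul, abs_pow, mul_pow, mul_div_right_comm]
  exact mul_le_mul_of_nonneg_right (hc n) (by positivity)

protected theorem IsEntireSeq.add (hc : IsEntireSeq c) (hd : IsEntireSeq d) : IsEntireSeq (c + d) :=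
  fun r => ((hc r).add (hd r)).congr fun _ => (add_mul _ _ _).symm

theorem IsEntireSeq.const_smul (hc : IsEntireSeq c) (x : ℝ) : IsEntireSeq (x • c) :=
  fun r => ((hc r).mul_left x).congr fun _ => (mul_assoc _ _ _).symm

theorem IsEntireSeq.summable_mul (hc : IsEntireSeq c) {C K : ℝ} (hu : ∀ n, |u n| ≤ C * K ^ n) :
    Summable fun n => c n * u n := by
  refine .of_norm_bounded ((hc K).abs.mul_left |C|) fun n => ?_
  rw [Real.norm_eq_abs, ← abs_mul, abs_mul, mul_left_comm, abs_mul]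
  exact mul_le_mul_of_nonneg_left ((hu n).trans (le_abs_self _)) (abs_nonneg _)

protected theorem IsEntireSeq.mul (hc : IsEntireSeq c) {C K : ℝ} (hu : ∀ n, |u n| ≤ C * K ^ n) :
    IsEntireSeq fun n => c n * u n := by
  intro r
  have hur : ∀ n, |u n * r ^ n| ≤ C * (K * |r|) ^ n := fun n => by
    rw [abs_mul, abs_pow, mul_pow, ← mul_assoc]
    exact mul_le_mul_of_nonneg_right (hu n) (by positivity)
  exact (hc.summable_mul hur).congr fun _ => (mul_assoc _ _ _).symm

theorem IsEntireSeq.mul_pow (hc : IsEntireSeq c) (b : ℝ) : IsEntireSeq fun n => c n * b ^ n :=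
  hc.mul (C := 1) (K := |b|) fun n => by rw [abs_pow, one_mul]

protected theorem IsEntireSeq.eulerSeq (hc : IsEntireSeq c) : IsEntireSeq (eulerSeq c) := by
  have hn : ∀ n : ℕ, |(n : ℝ)| ≤ 1 * 2 ^ n := fun n => by
    rw [Nat.abs_cast, one_mul]
    exact_mod_cast Nat.lt_two_pow_self.le
  exact fun r => (hc.mul hn r).congr fun n => by rw [eulerSeq, mul_comm (n : ℝ)]

protected theorem IsEntireSeq.derivSeq (hc : IsEntireSeq c) : IsEntireSeq (derivSeq c) := by
  intro r
  rcases eq_or_ne r 0 with rfl | hr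
  · exact summable_of_ne_finset_zero (s := {0}) fun n hn => by
      rw [zero_pow (by simpa using hn), mul_zero]
  · refine (((summable_nat_add_iff 1).mpr (hc.eulerSeq r)).mul_right r⁻¹).congr fun n => ?_
    simp only [eulerSeq, derivSeq, pow_succ]
    push_cast
    field_simp

theorem tsum_eulerSeq_mul (h : Summable fun n => derivSeq c n * u (n + 1)) :
    ∑' n, eulerSeq c n * u n = ∑' n, derivSeq c n * u (n + 1) := by
  have hsucc : ∀ n, eulerSeq c (n + 1) * u (n + 1) = derivSeq c n * u (n + 1) := fun n => by
    rw [eulerSeq, derivSeq, Nat.cast_add_one]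
  rw [tsum_eq_zero_add' (by simpa only [hsucc] using h), tsum_congr hsucc, eulerSeq,
    Nat.cast_zero, zero_mul, zero_mul, zero_add]

theorem summable_eulerSeq_mul (h : Summable fun n => derivSeq c n * u (n + 1)) :
    Summable fun n => eulerSeq c n * u n := by
  refine (summable_nat_add_iff 1).mp (h.congr fun n => ?_)
  rw [eulerSeq, derivSeq, Nat.cast_add_one]

theorem IsEntireSeq.hasDerivAt_tsum_mul_pow (hc : IsEntireSeq c) (a : ℝ) :
    HasDerivAt (fun b => ∑' n, c n * b ^ n) (∑' n, derivSeq c n * a ^ n) a := by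
  have ha : a ∈ Metric.ball (0 : ℝ) (|a| + 1) := by simp
  have hderiv : ∀ (n : ℕ) (b : ℝ),
      HasDerivAt (fun b => c n * b ^ n) (eulerSeq c n * b ^ (n - 1)) b := fun n b => by
    refine ((hasDerivAt_pow n b).const_mul (c n)).congr_deriv ?_
    rw [eulerSeq]
    ring
  have hbound : ∀ n, ∀ b ∈ Metric.ball (0 : ℝ) (|a| + 1),
      ‖eulerSeq c n * b ^ (n - 1)‖ ≤ |eulerSeq c n * (|a| + 1) ^ (n - 1)| := fun n b hb => by
    rw [norm_mul, norm_pow, abs_mul, abs_pow]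
    have hb' : ‖b‖ ≤ |(|a| + 1)| := (mem_ball_zero_iff.mp hb).le.trans (le_abs_self _)
    exact mul_le_mul_of_nonneg_left (pow_le_pow_left₀ (norm_nonneg b) hb' _) (abs_nonneg _)
  have hshift : ∀ b : ℝ, Summable fun n => derivSeq c n * b ^ (n + 1 - 1) := fun b => by
    simpa only [Nat.add_sub_cancel] using hc.derivSeq b
  have hsum : ∀ b : ℝ, Summable fun n => eulerSeq c n * b ^ (n - 1) := fun b =>
    summable_eulerSeq_mul (u := fun n => b ^ (n - 1)) (hshift b)
  have htsum : ∑' n, eulerSeq c n * a ^ (n - 1) = ∑' n, derivSeq c n * a ^ (n + 1 - 1) :=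
    tsum_eulerSeq_mul (u := fun n => a ^ (n - 1)) (hshift a)
  simp only [Nat.add_sub_cancel] at htsum
  rw [← htsum]
  exact hasDerivAt_tsum_of_isPreconnected (hsum _).abs Metric.isOpen_ball
    (convex_ball 0 _).isPreconnected (fun n b _ => hderiv n b) hbound ha (hc a) ha

theorem IsEntireSeq.hasDerivAt_tsum_mul_pow_of_ne_zero (hc : IsEntireSeq c) {a : ℝ} (ha : a ≠ 0) :
    HasDerivAt (fun b => ∑' n, c n * b ^ n) (1 / a * ∑' n, eulerSeq c n * a ^ n) a := by
  have hsucc : ∀ n, derivSeq c n * a ^ (n + 1) = a * (derivSeq c n * a ^ n) :=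
    fun n => by ring
  refine (hc.hasDerivAt_tsum_mul_pow a).congr_deriv ?_
  rw [tsum_eulerSeq_mul (by simpa only [hsucc] using (hc.derivSeq a).mul_left a)]
  simp only [hsucc, tsum_mul_left]
  field_simp

end EntireSeq

section Erlang

/-- The density of the Erlang law of shape `k` and rate `1`, extended by `0` to `k ≤ 0` so that its
recurrences hold for all integers `k`. -/
def erlang : ℤ → ℝ → ℝ
  | .ofNat (k + 1), t => t ^ k * Real.exp (-t) / (k ! : ℝ)
  | _, _ => 0

theorem erlang_natCast_add_one (k : ℕ) (t : ℝ) :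
    erlang ((k : ℤ) + 1) t = t ^ k * Real.exp (-t) / (k ! : ℝ) := rfl

theorem erlang_of_nonpos {k : ℤ} (hk : k ≤ 0) (t : ℝ) : erlang k t = 0 := by
  match k, hk with
  | .ofNat 0, _ => rfl
  | .negSucc _, _ => rfl

theorem nonpos_or_exists_eq_natCast_add_one (k : ℤ) : k ≤ 0 ∨ ∃ j : ℕ, k = (j : ℤ) + 1 :=
  (le_or_gt k 0).imp_right fun hk => ⟨(k - 1).toNat, by lia⟩

theorem mul_erlang (k : ℤ) (t : ℝ) : t * erlang k t = k * erlang (k + 1) t := by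
  obtain hk | ⟨j, rfl⟩ := nonpos_or_exists_eq_natCast_add_one k
  · rcases hk.eq_or_lt with rfl | hk
    · rw [erlang_of_nonpos le_rfl, Int.cast_zero, mul_zero, zero_mul]
    · rw [erlang_of_nonpos hk.le, erlang_of_nonpos (by lia), mul_zero, mul_zero]
  · have h := erlang_natCast_add_one (j + 1) t
    push_cast at h
    rw [h, erlang_natCast_add_one, Nat.factorial_succ]
    push_cast
    field_simp
    ring

theorem hasDerivAt_erlang (k : ℤ) (t : ℝ) :
    HasDerivAt (erlang k) (erlang (k - 1) t - erlang k t) t := by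
  obtain hk | ⟨j, rfl⟩ := nonpos_or_exists_eq_natCast_add_one k
  · rw [funext (erlang_of_nonpos hk), erlang_of_nonpos (by lia), sub_zero]
    exact hasDerivAt_const t 0
  · refine (((hasDerivAt_pow j t).mul (hasDerivAt_neg t).exp).div_const (j ! : ℝ)).congr_deriv ?_
    rw [add_sub_cancel_right, erlang_natCast_add_one]
    rcases j with _ | j
    · simp [erlang_of_nonpos]
    · push_cast
      rw [erlang_natCast_add_one, Nat.factorial_succ]
      push_cast
      field_simp
      ring

theorem erlang_nonneg (k : ℤ) {t : ℝ} (ht : 0 ≤ t) : 0 ≤ erlang k t := by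
  obtain hk | ⟨j, rfl⟩ := nonpos_or_exists_eq_natCast_add_one k
  · rw [erlang_of_nonpos hk]
  · rw [erlang_natCast_add_one]
    positivity

theorem abs_erlang_le (k : ℤ) (t : ℝ) : |erlang k t| ≤ Real.exp (2 * |t|) := by
  obtain hk | ⟨j, rfl⟩ := nonpos_or_exists_eq_natCast_add_one k
  · rw [erlang_of_nonpos hk, abs_zero]
    positivity
  · rw [erlang_natCast_add_one, mul_div_right_comm, abs_mul, abs_div, abs_pow, Real.abs_exp,
      Nat.abs_cast, two_mul, Real.exp_add]
    gcongr
    · exact Real.pow_div_factorial_le_exp _ (abs_nonneg t) j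
    · exact neg_le_abs t

/-- The `n`-th forward difference of the Erlang densities with respect to the shape `k`. -/
def erlangDiff (n : ℕ) (k : ℤ) (t : ℝ) : ℝ :=
  (fwdDiff 1)^[n] (fun j => erlang j t) k

theorem erlangDiff_zero (k : ℤ) (t : ℝ) : erlangDiff 0 k t = erlang k t := rfl

theorem erlangDiff_succ (n : ℕ) (k : ℤ) (t : ℝ) :
    erlangDiff (n + 1) k t = erlangDiff n (k + 1) t - erlangDiff n k t := by
  simp only [erlangDiff, Function.iterate_succ_apply', fwdDiff]

theorem erlangDiff_eq_sum (n : ℕ) (k : ℤ) (t : ℝ) :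
    erlangDiff n k t =
      ∑ m ∈ Finset.range (n + 1), (n.choose m : ℝ) * ((-1) ^ m * erlang (k + n - m) t) := by
  rw [erlangDiff, fwdDiff_iter_eq_sum_shift, ← Finset.sum_range_reflect]
  refine Finset.sum_congr rfl fun m hm => ?_
  have hmn : m ≤ n := Finset.mem_range_succ_iff.mp hm
  have hshape : k + (n - m) • 1 = k + n - m := by simp [hmn, add_sub_assoc]
  rw [Nat.add_sub_cancel, Nat.sub_sub_self hmn, Nat.choose_symm hmn, hshape, zsmul_eq_mul]
  push_cast
  ring

/-- The Leibniz rule for the `n`-th difference of `k ↦ k * erlang (k + 1) t`; the truncation in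
`n - 1` only occurs next to the factor `n = 0`. -/
theorem mul_erlangDiff (n : ℕ) (k : ℤ) (t : ℝ) :
    t * erlangDiff n k t = k * erlangDiff n (k + 1) t + n * erlangDiff (n - 1) (k + 2) t := by
  induction n generalizing k with
  | zero => simpa [erlangDiff_zero] using mul_erlang k t
  | succ n ih =>
    have hk : k + 1 + 2 = k + 2 + 1 := by ring
    have hsucc := erlangDiff_succ n (k + 1) t
    rw [add_assoc k 1 1, one_add_one_eq_two] at hsucc
    rw [erlangDiff_succ, mul_sub, ih, ih, hk, add_assoc k 1 1, one_add_one_eq_two, hsucc]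
    rcases n with _ | n
    · push_cast
      ring
    · have hpred := erlangDiff_succ n (k + 2) t
      simp only [Nat.add_sub_cancel]
      push_cast
      linear_combination -(n + 1 : ℝ) * hpred

theorem hasDerivAt_erlangDiff (n : ℕ) (k : ℤ) (t : ℝ) :
    HasDerivAt (erlangDiff n k) (erlangDiff n (k - 1) t - erlangDiff n k t) t := by
  induction n generalizing k with
  | zero => exact hasDerivAt_erlang k t
  | succ n ih =>
    have hfun : erlangDiff (n + 1) k = erlangDiff n (k + 1) - erlangDiff n k :=
      funext (erlangDiff_succ n k)
    rw [erlangDiff_succ, erlangDiff_succ, sub_add_cancel, hfun]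
    refine ((ih (k + 1)).sub (ih k)).congr_deriv ?_
    rw [add_sub_cancel_right]
    ring

theorem abs_erlangDiff_le (n : ℕ) (k : ℤ) (t : ℝ) :
    |erlangDiff n k t| ≤ Real.exp (2 * |t|) * 2 ^ n := by
  induction n generalizing k with
  | zero => simpa [erlangDiff_zero] using abs_erlang_le k t
  | succ n ih =>
    rw [erlangDiff_succ, pow_succ]
    linarith [abs_sub (erlangDiff n (k + 1) t) (erlangDiff n k t), ih k, ih (k + 1)]

end Erlang

section ErlangSeries

/-- The Erlang density of shape `k` acted upon by the power series with coefficients `c` in the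
forward difference operator of the shape. -/
def erlangSeries (c : ℕ → ℝ) (k : ℤ) (t : ℝ) : ℝ :=
  ∑' n, c n * erlangDiff n k t

variable {c d : ℕ → ℝ}

theorem IsEntireSeq.summable_mul_erlangDiff (hc : IsEntireSeq c) (k : ℤ) (t : ℝ) :
    Summable fun n => c n * erlangDiff n k t :=
  hc.summable_mul fun n => abs_erlangDiff_le n k t

theorem erlangSeries_smul (x : ℝ) (c : ℕ → ℝ) (k : ℤ) (t : ℝ) :
    erlangSeries (x • c) k t = x * erlangSeries c k t := by
  simp only [erlangSeries, Pi.smul_apply, smul_eq_mul, mul_assoc, tsum_mul_left]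

theorem erlangSeries_add (hc : IsEntireSeq c) (hd : IsEntireSeq d) (k : ℤ) (t : ℝ) :
    erlangSeries (c + d) k t = erlangSeries c k t + erlangSeries d k t := by
  simp only [erlangSeries, Pi.add_apply, add_mul]
  exact (hc.summable_mul_erlangDiff k t).tsum_add (hd.summable_mul_erlangDiff k t)

theorem erlangSeries_eulerSeq (hc : IsEntireSeq c) (k : ℤ) (t : ℝ) :
    erlangSeries (eulerSeq c) k t =
      erlangSeries (derivSeq c) (k + 1) t - erlangSeries (derivSeq c) k t := by
  have hsucc := hc.derivSeq.summable_mul_erlangDiff (k + 1) t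
  have hself := hc.derivSeq.summable_mul_erlangDiff k t
  have hsub : Summable fun n => derivSeq c n * erlangDiff (n + 1) k t := by
    simpa only [erlangDiff_succ, mul_sub] using hsucc.sub hself
  have htsum : ∑' n, eulerSeq c n * erlangDiff n k t =
      ∑' n, derivSeq c n * erlangDiff (n + 1) k t :=
    tsum_eulerSeq_mul (u := fun n => erlangDiff n k t) hsub
  simp only [erlangSeries]
  rw [htsum, ← hsucc.tsum_sub hself]
  simp only [erlangDiff_succ, mul_sub]

theorem mul_erlangSeries (hc : IsEntireSeq c) (k : ℤ) (t : ℝ) :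
    t * erlangSeries c k t =
      k * erlangSeries c (k + 1) t + erlangSeries (derivSeq c) (k + 2) t := by
  have hshift : Summable fun n => derivSeq c n * erlangDiff (n + 1 - 1) (k + 2) t :=
    hc.derivSeq.summable_mul_erlangDiff (k + 2) t
  have hterm : ∀ n, t * (c n * erlangDiff n k t) =
      k * (c n * erlangDiff n (k + 1) t) + eulerSeq c n * erlangDiff (n - 1) (k + 2) t :=
    fun n => by
      rw [mul_left_comm, mul_erlangDiff, eulerSeq]
      ring
  have htsum : ∑' n, eulerSeq c n * erlangDiff (n - 1) (k + 2) t =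
      ∑' n, derivSeq c n * erlangDiff (n + 1 - 1) (k + 2) t :=
    tsum_eulerSeq_mul (u := fun n => erlangDiff (n - 1) (k + 2) t) hshift
  simp only [Nat.add_sub_cancel] at htsum
  simp only [erlangSeries]
  rw [← htsum, ← tsum_mul_left, ← tsum_mul_left, tsum_congr hterm]
  exact ((hc.summable_mul_erlangDiff (k + 1) t).mul_left _).tsum_add
    (summable_eulerSeq_mul (u := fun n => erlangDiff (n - 1) (k + 2) t) hshift)

theorem erlangSeries_derivSeq (hc : IsEntireSeq c) (k : ℤ) (t : ℝ) :
    erlangSeries (derivSeq c) k t =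
      t * erlangSeries c (k - 2) t - (k - 2) * erlangSeries c (k - 1) t := by
  have h := mul_erlangSeries hc (k - 2) t
  rw [sub_add_cancel, show k - 2 + 1 = k - 1 by ring] at h
  push_cast at h
  linear_combination -h

theorem hasDerivAt_erlangSeries (hc : IsEntireSeq c) (k : ℤ) (t : ℝ) :
    HasDerivAt (erlangSeries c k) (erlangSeries c (k - 1) t - erlangSeries c k t) t := by
  have ht : t ∈ Metric.ball (0 : ℝ) (|t| + 1) := by simp
  have hbound : ∀ n, ∀ s ∈ Metric.ball (0 : ℝ) (|t| + 1),
      ‖c n * (erlangDiff n (k - 1) s - erlangDiff n k s)‖ ≤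
        |c n * (2 * Real.exp (2 * (|t| + 1)) * 2 ^ n)| := fun n s hs => by
    have hexp : Real.exp (2 * |s|) * 2 ^ n ≤ Real.exp (2 * (|t| + 1)) * 2 ^ n := by
      gcongr
      exact (mem_ball_zero_iff.mp hs).le
    rw [Real.norm_eq_abs, abs_mul, abs_mul]
    refine mul_le_mul_of_nonneg_left (le_trans ?_ (le_abs_self _)) (abs_nonneg _)
    linarith [abs_sub (erlangDiff n (k - 1) s) (erlangDiff n k s), abs_erlangDiff_le n (k - 1) s,
      abs_erlangDiff_le n k s]
  have hsum : Summable fun n => c n * (2 * Real.exp (2 * (|t| + 1)) * 2 ^ n) :=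
    hc.summable_mul fun n => (abs_of_nonneg (by positivity)).le
  refine (hasDerivAt_tsum_of_isPreconnected hsum.abs Metric.isOpen_ball
    (convex_ball 0 _).isPreconnected (fun n s _ => (hasDerivAt_erlangDiff n k s).const_mul (c n))
    hbound ht (hc.summable_mul_erlangDiff k t) ht).congr_deriv ?_
  simp only [mul_sub]
  exact (hc.summable_mul_erlangDiff (k - 1) t).tsum_sub (hc.summable_mul_erlangDiff k t)

theorem deriv_erlangSeries (hc : IsEntireSeq c) (k : ℤ) :
    deriv (erlangSeries c k) = erlangSeries c (k - 1) - erlangSeries c k :=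
  funext fun t => (hasDerivAt_erlangSeries hc k t).deriv

theorem contDiff_erlangSeries (hc : IsEntireSeq c) (k : ℤ) : ContDiff ℝ ∞ (erlangSeries c k) := by
  refine contDiff_infty.mpr fun n => ?_
  induction n generalizing k with
  | zero =>
    exact contDiff_zero.mpr (continuous_iff_continuousAt.mpr fun t =>
      (hasDerivAt_erlangSeries hc k t).continuousAt)
  | succ n ih =>
    rw [Nat.cast_add_one, contDiff_succ_iff_deriv]
    refine ⟨fun t => (hasDerivAt_erlangSeries hc k t).differentiableAt,
      fun h => absurd h (by exact_mod_cast WithTop.coe_ne_top), ?_⟩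
    rw [deriv_erlangSeries hc]
    exact (ih (k - 1)).sub (ih k)

theorem iteratedDeriv_succ_erlangSeries (hc : IsEntireSeq c) (l : ℕ) (k : ℤ) (t : ℝ) :
    iteratedDeriv (l + 1) (erlangSeries c k) t =
      iteratedDeriv l (erlangSeries c (k - 1)) t - iteratedDeriv l (erlangSeries c k) t := by
  have hsmooth : ∀ j, ContDiffAt ℝ l (erlangSeries c j) t := fun j =>
    (contDiff_infty.mp (contDiff_erlangSeries hc j) l).contDiffAt
  rw [iteratedDeriv_succ', deriv_erlangSeries hc, iteratedDeriv_sub (hsmooth _) (hsmooth _)]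

theorem erlangSeries_sub_one (hc : IsEntireSeq c) (k : ℤ) (t : ℝ) :
    erlangSeries c (k - 1) t =
      erlangSeries c k t + iteratedDeriv 1 (erlangSeries c k) t := by
  rw [iteratedDeriv_succ_erlangSeries hc, iteratedDeriv_zero, iteratedDeriv_zero]
  ring

theorem erlangSeries_sub_two (hc : IsEntireSeq c) (k : ℤ) (t : ℝ) :
    erlangSeries c (k - 2) t = erlangSeries c k t + 2 * iteratedDeriv 1 (erlangSeries c k) t +
      iteratedDeriv 2 (erlangSeries c k) t := by
  rw [iteratedDeriv_succ_erlangSeries hc 1, iteratedDeriv_succ_erlangSeries hc 0 (k - 1),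
    iteratedDeriv_zero, iteratedDeriv_zero, sub_sub k 1 1, one_add_one_eq_two,
    erlangSeries_sub_one hc]
  ring

theorem iteratedDeriv_erlangSeries_eulerSeq (hc : IsEntireSeq c) (l : ℕ) (k : ℤ) (t : ℝ) :
    iteratedDeriv l (erlangSeries (eulerSeq c) k) t =
      -(l + 1) * iteratedDeriv l (erlangSeries c k) t
        + (k - 2 - l - t) * iteratedDeriv (l + 1) (erlangSeries c k) t
        - t * iteratedDeriv (l + 2) (erlangSeries c k) t := by
  induction l generalizing k with
  | zero =>
    have h₁ := erlangSeries_derivSeq hc (k + 1) t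
    rw [add_sub_cancel_right, show k + 1 - 2 = k - 1 by ring] at h₁
    rw [iteratedDeriv_zero, iteratedDeriv_zero, erlangSeries_eulerSeq hc, h₁,
      erlangSeries_derivSeq hc, erlangSeries_sub_two hc, erlangSeries_sub_one hc]
    push_cast
    ring
  | succ l ih =>
    have h₁ := iteratedDeriv_succ_erlangSeries hc (l + 1) k t
    have h₂ := iteratedDeriv_succ_erlangSeries hc (l + 2) k t
    rw [iteratedDeriv_succ_erlangSeries hc.eulerSeq, ih, ih]
    push_cast
    linear_combination (l + 1 : ℝ) * iteratedDeriv_succ_erlangSeries hc l k t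
      - (k - 3 - l - t) * h₁ + t * h₂

theorem mul_iteratedDeriv_one_erlangSeries (hc : IsEntireSeq c) (k : ℤ) (t : ℝ) :
    t * iteratedDeriv 1 (erlangSeries c k) t = (k - 1) * erlangSeries c k t -
      (k * erlangSeries c (k + 1) t + erlangSeries (eulerSeq c) (k + 1) t) := by
  have hderiv := erlangSeries_derivSeq hc (k + 1) t
  rw [add_sub_cancel_right, show k + 1 - 2 = k - 1 by ring] at hderiv
  rw [erlangSeries_eulerSeq hc, hderiv, erlangSeries_sub_one hc, add_assoc k 1 1,
    one_add_one_eq_two]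
  push_cast
  linear_combination -mul_erlangSeries hc k t

/-- For the power series `f` with coefficients `c`, the hypothesis is the confluent hypergeometric
equation `d/dx ((R - 1) f + x df/dx) = a (κ f + x df/dx)`, satisfied by `₁F₁(κ; R; a x)`. -/
theorem erlangSeries_hypergeometric {a κ R : ℝ} (hc : IsEntireSeq c)
    (hrec : derivSeq ((R - 1) • c + eulerSeq c) = a • (κ • c + eulerSeq c)) (k : ℤ) (t : ℝ) :
    t * ((R - 1) * erlangSeries c (k - 2) t + erlangSeries (eulerSeq c) (k - 2) t) -
        (k - 2) * ((R - 1) * erlangSeries c (k - 1) t + erlangSeries (eulerSeq c) (k - 1) t) =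
      a * (κ * erlangSeries c k t + erlangSeries (eulerSeq c) k t) := by
  have h := congrArg (erlangSeries · k t) hrec
  have hR := hc.const_smul (R - 1)
  simpa only [erlangSeries_derivSeq (hR.add hc.eulerSeq), erlangSeries_add hR hc.eulerSeq,
    erlangSeries_add (hc.const_smul κ) hc.eulerSeq, erlangSeries_smul] using h

theorem hasDerivAt_iteratedDeriv_erlangSeries_mul_pow (hc : IsEntireSeq c) {a : ℝ} (ha : a ≠ 0)
    (l : ℕ) (k : ℤ) (t : ℝ) :
    HasDerivAt (fun b => iteratedDeriv l (erlangSeries (fun n => c n * b ^ n) k) t)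
      (1 / a * iteratedDeriv l (erlangSeries (eulerSeq fun n => c n * a ^ n) k) t) a := by
  induction l generalizing k with
  | zero =>
    have hterms : IsEntireSeq fun n => c n * erlangDiff n k t :=
      hc.mul fun n => abs_erlangDiff_le n k t
    have h := hterms.hasDerivAt_tsum_mul_pow_of_ne_zero ha
    simp only [iteratedDeriv_zero, erlangSeries, eulerSeq, mul_right_comm _ (_ ^ _),
      ← mul_assoc] at h ⊢
    exact h
  | succ l ih =>
    simp only [iteratedDeriv_succ_erlangSeries (hc.mul_pow _),
      iteratedDeriv_succ_erlangSeries (hc.mul_pow a).eulerSeq, mul_sub]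
    exact (ih (k - 1)).sub (ih k)

end ErlangSeries

section DifferentialSystem

variable {N NR : ℕ}

theorem coeffA_eq_mul_pow (N NR n : ℕ) (a : ℝ) : coeffA N NR n a = coeffA N NR n 1 * a ^ n := by
  rw [coeffA, coeffA, one_pow]
  ring

theorem factorial_le_ascFactorial (hNR : 1 ≤ NR) (n : ℕ) : n ! ≤ NR.ascFactorial n :=
  (Nat.one_ascFactorial n).symm.trans_le (Nat.ascFactorial_le n hNR)

theorem abs_coeffA_le (N : ℕ) (hNR : 1 ≤ NR) (n : ℕ) (a : ℝ) :
    |coeffA N NR n a| ≤ (N * |a|) ^ n / (n ! : ℝ) := by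
  have hden : (n ! : ℝ) ≤ NR.ascFactorial n := by
    exact_mod_cast factorial_le_ascFactorial hNR n
  have hnum : (N.ascFactorial n : ℝ) ≤ n ! * N ^ n := by
    exact_mod_cast Nat.ascFactorial_le_factorial_mul_pow N n
  have hratio : (N.ascFactorial n : ℝ) / NR.ascFactorial n ≤ N ^ n := by
    have hpos : (0 : ℝ) < n ! := by positivity
    rw [div_le_iff₀ (hpos.trans_le hden)]
    nlinarith [pow_nonneg (Nat.cast_nonneg (α := ℝ) N) n]
  rw [coeffA, abs_mul, abs_div, abs_div, abs_pow, Nat.abs_cast, Nat.abs_cast, Nat.abs_cast,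
    mul_pow, mul_div_assoc]
  gcongr

theorem isEntireSeq_coeffA (N : ℕ) (hNR : 1 ≤ NR) (a : ℝ) :
    IsEntireSeq fun n => coeffA N NR n a :=
  isEntireSeq_of_abs_le fun n => abs_coeffA_le N hNR n a

theorem coeffA_recurrence (N : ℕ) (hNR : 1 ≤ NR) (n : ℕ) (a : ℝ) :
    (n + 1) * (NR + n) * coeffA N NR (n + 1) a = a * (N + n) * coeffA N NR n a := by
  have hne : (NR : ℝ) + n ≠ 0 := by
    exact_mod_cast (Nat.add_pos_left hNR n).ne'
  simp only [coeffA, Nat.ascFactorial_succ, Nat.factorial_succ, pow_succ]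
  push_cast
  field_simp [hne]

theorem derivSeq_coeffA (N : ℕ) (hNR : 1 ≤ NR) (a : ℝ) :
    derivSeq (((NR : ℝ) - 1) • (fun n => coeffA N NR n a) + eulerSeq fun n => coeffA N NR n a) =
      a • ((N : ℝ) • (fun n => coeffA N NR n a) + eulerSeq fun n => coeffA N NR n a) := by
  ext n
  simp only [derivSeq, eulerSeq, Pi.add_apply, Pi.smul_apply, smul_eq_mul]
  push_cast
  linear_combination coeffA_recurrence N hNR n a

theorem snrPdf_eq_erlangSeries (hN : 1 ≤ N) (NR : ℕ) (a : ℝ) :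
    (fun t => snrPdf N NR t a) = erlangSeries (fun n => coeffA N NR n a) N := by
  ext t
  refine tsum_congr fun n => ?_
  rw [erlangDiff_eq_sum]
  congr 1
  refine Finset.sum_congr rfl fun m hm => ?_
  have hmn : m ≤ n := Finset.mem_range_succ_iff.mp hm
  have hshape : (N : ℤ) + n - m = ((N + n - m - 1 : ℕ) : ℤ) + 1 := by lia
  rw [hshape, erlang_natCast_add_one]
  ring

theorem snrPdfDeriv_eq_iteratedDeriv_erlangSeries (hN : 1 ≤ N) (NR l : ℕ) (t a : ℝ) :
    snrPdfDeriv N NR l t a = iteratedDeriv l (erlangSeries (fun n => coeffA N NR n a) N) t := by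
  rw [snrPdfDeriv, snrPdf_eq_erlangSeries hN]

theorem contDiff_snrPdf (hN : 1 ≤ N) (hNR : 1 ≤ NR) (a : ℝ) :
    ContDiff ℝ ∞ fun t => snrPdf N NR t a := by
  rw [snrPdf_eq_erlangSeries hN]
  exact contDiff_erlangSeries (isEntireSeq_coeffA N hNR a) N

theorem hasDerivAt_snrPdfDeriv (hN : 1 ≤ N) (hNR : 1 ≤ NR) {a : ℝ} (ha : a ≠ 0) (l : ℕ) (t : ℝ) :
    HasDerivAt (fun b => snrPdfDeriv N NR l t b)
      (1 / a * iteratedDeriv l (erlangSeries (eulerSeq fun n => coeffA N NR n a) N) t) a := by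
  have h := hasDerivAt_iteratedDeriv_erlangSeries_mul_pow (isEntireSeq_coeffA N hNR 1) ha l N t
  simpa only [← coeffA_eq_mul_pow, snrPdfDeriv_eq_iteratedDeriv_erlangSeries hN] using h

theorem mul_deriv_snrPdfDeriv (hN : 1 ≤ N) (hNR : 1 ≤ NR) {a : ℝ} (ha : a ≠ 0) (l : ℕ) (t : ℝ) :
    a * deriv (fun b => snrPdfDeriv N NR l t b) a =
      -(l + 1) * snrPdfDeriv N NR l t a + (N - 2 - l - t) * snrPdfDeriv N NR (l + 1) t a
        - t * snrPdfDeriv N NR (l + 2) t a := by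
  have h := iteratedDeriv_erlangSeries_eulerSeq (isEntireSeq_coeffA N hNR a) l N t
  rw [(hasDerivAt_snrPdfDeriv hN hNR ha l t).deriv, h]
  simp only [snrPdfDeriv_eq_iteratedDeriv_erlangSeries hN, Int.cast_natCast]
  field_simp

/-- The unknowns are `p`, `∂ₜ p`, `∂ₜ² p` and `q`, `∂ₜ q`, `∂ₜ² q` for `q = a ∂ₐ p`. -/
theorem matQ_mulVec_eq_of_relations {N R t a p₀ p₁ p₂ q₀ q₁ q₂ : ℝ} (ht : t ≠ 0)
    (h₀ : q₀ = -p₀ + (N - t - 2) * p₁ - t * p₂)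
    (h₁ : t * ((R - 1) * (p₀ + p₁) + (q₀ + q₁)) - (N - 1) * ((R - 1) * p₀ + q₀) =
      a * ((N - 1) * p₀ - t * p₁))
    (h₂ : t * ((R - 1) * (p₀ + 2 * p₁ + p₂) + (q₀ + 2 * q₁ + q₂)) -
        (N - 2) * ((R - 1) * (p₀ + p₁) + (q₀ + q₁)) = a * (N * p₀ + q₀)) :
    matQ N R t a *ᵥ ![p₀, p₁, p₂] = ![q₀, q₁, q₂] := by
  simp only [matQ, Matrix.cons_mulVec, Matrix.vec3_dotProduct', Matrix.empty_mulVec]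
  refine Matrix.vec3_eq ?_ ?_ ?_
  · linear_combination -h₀
  · field_simp
    linear_combination -h₁ + (t - N + 1) * h₀
  · field_simp
    linear_combination -t * h₂ + (2 * t - N + 2) * h₁
      + (t * (t - N + 2 - a) - (2 * t - N + 2) * (t - N + 1)) * h₀

theorem vec3_iteratedDeriv (f : ℝ → ℝ) (t : ℝ) :
    ![f t, iteratedDeriv 1 f t, iteratedDeriv 2 f t] = fun i : Fin 3 => iteratedDeriv i f t := by
  ext i
  fin_cases i
  exacts [(congrFun iteratedDeriv_zero t).symm, rfl, rfl]

theorem matQ_mulVec_erlangSeries {c : ℕ → ℝ} {a R t : ℝ} {k : ℤ} (hc : IsEntireSeq c)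
    (hrec : derivSeq ((R - 1) • c + eulerSeq c) = a • ((k : ℝ) • c + eulerSeq c)) (ht : t ≠ 0) :
    (matQ k R t a *ᵥ fun i : Fin 3 => iteratedDeriv i (erlangSeries c k) t) =
      fun i : Fin 3 => iteratedDeriv i (erlangSeries (eulerSeq c) k) t := by
  have hθ := iteratedDeriv_erlangSeries_eulerSeq hc 0 k t
  have hnext := erlangSeries_hypergeometric hc hrec (k + 1) t
  have hself := erlangSeries_hypergeometric hc hrec k t
  rw [add_sub_cancel_right, show k + 1 - 2 = k - 1 by ring] at hnext
  simp only [erlangSeries_sub_one hc, erlangSeries_sub_one hc.eulerSeq, erlangSeries_sub_two hc,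
    erlangSeries_sub_two hc.eulerSeq] at hnext hself
  rw [← vec3_iteratedDeriv, ← vec3_iteratedDeriv]
  refine matQ_mulVec_eq_of_relations ht ?_ ?_ ?_
  · simp only [iteratedDeriv_zero, zero_add, Nat.cast_zero] at hθ
    linear_combination hθ
  · push_cast at hnext
    linear_combination hnext + a * mul_iteratedDeriv_one_erlangSeries hc k t
  · linear_combination hself

theorem hasDerivAt_snrVec (hN : 1 ≤ N) (hNR : 1 ≤ NR) {t a : ℝ} (ht : t ≠ 0) (ha : a ≠ 0) :
    HasDerivAt (fun b => snrVec N NR t b) ((1 / a) • (matQ N NR t a *ᵥ snrVec N NR t a)) a := by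
  have hQ := matQ_mulVec_erlangSeries (k := N) (isEntireSeq_coeffA N hNR a)
    (derivSeq_coeffA N hNR a) ht
  have hvec : ∀ b, snrVec N NR t b = fun i : Fin 3 => snrPdfDeriv N NR i t b := fun b =>
    vec3_iteratedDeriv (fun τ => snrPdf N NR τ b) t
  rw [Int.cast_natCast] at hQ
  simp only [← snrPdfDeriv_eq_iteratedDeriv_erlangSeries hN] at hQ
  simp only [hvec, hQ]
  exact hasDerivAt_pi.mpr fun i => hasDerivAt_snrPdfDeriv hN hNR ha i t

end DifferentialSystem

section Positivity

/-- Hausdorff's complete monotonicity, which characterises the moment sequences of the measures on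
`[0, 1]`. -/
def CompletelyMonotone (m : ℕ → ℝ) : Prop :=
  ∀ r i, 0 ≤ (-1) ^ r * (fwdDiff 1)^[r] m i

variable {m : ℕ → ℝ}

theorem CompletelyMonotone.nonneg (hm : CompletelyMonotone m) (i : ℕ) : 0 ≤ m i := by
  simpa only [pow_zero, one_mul, Function.iterate_zero_apply] using hm 0 i

theorem CompletelyMonotone.shift (hm : CompletelyMonotone m) :
    CompletelyMonotone fun i => m (i + 1) := fun r i => by
  rw [fwdDiff_iter_comp_add]
  exact hm r (i + 1)

theorem CompletelyMonotone.sub_shift (hm : CompletelyMonotone m) :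
    CompletelyMonotone fun i => m i - m (i + 1) := fun r i => by
  have hneg : (fun i => m i - m (i + 1)) = (-1 : ℝ) • fwdDiff 1 m := by
    ext i
    simp only [fwdDiff, Pi.smul_apply, smul_eq_mul]
    ring
  have h := hm (r + 1) i
  rw [hneg, fwdDiff_iter_const_smul, ← Function.iterate_succ_apply, Pi.smul_apply, smul_eq_mul,
    ← mul_assoc, ← pow_succ]
  exact h

/-- For `m n = u ^ n` the sum is `((1 - u) + u S) ^ j f x`, where `S` is the shift by `h`. -/
theorem CompletelyMonotone.sum_choose_mul_fwdDiff_nonneg {M : Type*} [AddCommMonoid M]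
    (hm : CompletelyMonotone m) {f : M → ℝ} (hf : ∀ x, 0 ≤ f x) (h : M) (j : ℕ) (x : M) :
    0 ≤ ∑ n ∈ Finset.range (j + 1), (j.choose n : ℝ) * (m n * (fwdDiff h)^[n] f x) := by
  induction j generalizing m x with
  | zero => simpa using mul_nonneg (hm.nonneg 0) (hf x)
  | succ j ih =>
    refine (add_nonneg (ih hm.sub_shift x) (ih hm.shift (x + h))).trans_eq ?_
    rw [Finset.sum_choose_succ_mul (fun n _ => m n * (fwdDiff h)^[n] f x) j,
      ← Finset.sum_add_distrib, ← Finset.sum_add_distrib]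
    refine Finset.sum_congr rfl fun n _ => ?_
    simp only [Function.iterate_succ_apply', fwdDiff]
    ring

theorem tsum_mul_pow_div_factorial_mul_exp {d : ℕ → ℝ} {a : ℝ}
    (hd : Summable fun n => d n * (a ^ n / (n ! : ℝ))) :
    (∑' n, d n * (a ^ n / (n ! : ℝ))) * Real.exp a =
      ∑' j : ℕ, (∑ n ∈ Finset.range (j + 1), (j.choose n : ℝ) * d n) * (a ^ j / (j ! : ℝ)) := by
  rw [Real.exp_eq_exp_ℝ, NormedSpace.exp_eq_tsum_div,
    tsum_mul_tsum_eq_tsum_sum_antidiagonal_of_summable_norm hd.norm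
      (Real.summable_pow_div_factorial a).norm]
  refine tsum_congr fun j => ?_
  rw [Finset.Nat.sum_antidiagonal_eq_sum_range_succ_mk, Finset.sum_mul]
  refine Finset.sum_congr rfl fun n hn => ?_
  have hnj : n ≤ j := Finset.mem_range_succ_iff.mp hn
  rw [Nat.cast_choose ℝ hnj, ← pow_mul_pow_sub a hnj]
  field_simp

theorem CompletelyMonotone.tsum_mul_fwdDiff_mul_pow_div_factorial_nonneg {M : Type*}
    [AddCommMonoid M] (hm : CompletelyMonotone m) {f : M → ℝ} (hf : ∀ x, 0 ≤ f x) {h x : M} {a : ℝ}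
    (ha : 0 ≤ a) (hsum : Summable fun n => m n * (fwdDiff h)^[n] f x * (a ^ n / (n ! : ℝ))) :
    0 ≤ ∑' n, m n * (fwdDiff h)^[n] f x * (a ^ n / (n ! : ℝ)) := by
  refine nonneg_of_mul_nonneg_left ?_ (Real.exp_pos a)
  rw [tsum_mul_pow_div_factorial_mul_exp hsum]
  exact tsum_nonneg fun j =>
    mul_nonneg (hm.sum_choose_mul_fwdDiff_nonneg hf h j x) (by positivity)

theorem fwdDiff_iter_ascFactorial_div {N K : ℕ} (h : 0 < N + K) (r i : ℕ) :
    (fwdDiff 1)^[r] (fun i => (N.ascFactorial i : ℝ) / (N + K).ascFactorial i) i =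
      (-1) ^ r * (N.ascFactorial i * K.ascFactorial r / (N + K).ascFactorial (i + r)) := by
  induction r generalizing i with
  | zero => simp
  | succ r ih =>
    have hasc : (((N + K).ascFactorial (i + r) : ℕ) : ℝ) ≠ 0 := by
      exact_mod_cast ((Nat.factorial_pos _).trans_le (factorial_le_ascFactorial h _)).ne'
    have hpos : ((N : ℝ) + K + (i + r)) ≠ 0 := by
      exact_mod_cast (Nat.add_pos_left h (i + r)).ne'
    rw [Function.iterate_succ_apply', fwdDiff, ih, ih, add_right_comm, ← add_assoc]
    simp only [Nat.ascFactorial_succ, pow_succ]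
    push_cast
    field_simp
    ring

theorem completelyMonotone_ascFactorial_div {N NR : ℕ} (hNR : 1 ≤ NR) (h : N ≤ NR) :
    CompletelyMonotone fun n => (N.ascFactorial n : ℝ) / NR.ascFactorial n := fun r i => by
  obtain ⟨K, rfl⟩ := Nat.exists_eq_add_of_le h
  rw [fwdDiff_iter_ascFactorial_div hNR, ← mul_assoc, ← mul_pow, neg_one_mul, neg_neg, one_pow,
    one_mul]
  positivity

theorem snrPdf_nonneg {N NR : ℕ} (hN : 1 ≤ N) (hNR : N ≤ NR) {t a : ℝ} (ht : 0 ≤ t) (ha : 0 ≤ a) :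
    0 ≤ snrPdf N NR t a := by
  have hNR₁ := hN.trans hNR
  have hterm : ∀ n, coeffA N NR n a * erlangDiff n N t =
      (N.ascFactorial n : ℝ) / NR.ascFactorial n * (fwdDiff 1)^[n] (fun k => erlang k t) N *
        (a ^ n / (n ! : ℝ)) := fun n => by
    rw [coeffA, erlangDiff, mul_right_comm]
  have hsum := (isEntireSeq_coeffA N hNR₁ a).summable_mul_erlangDiff N t
  rw [show snrPdf N NR t a = _ from congrFun (snrPdf_eq_erlangSeries hN NR a) t, erlangSeries,
    tsum_congr hterm]
  exact (completelyMonotone_ascFactorial_div hNR₁ hNR).tsum_mul_fwdDiff_mul_pow_div_factorial_nonneg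
    (fun k => erlang_nonneg k ht) ha (hsum.congr hterm)

end Positivity

section Law

variable {s : ℝ}

theorem integral_exp_mul_erlang (hs : s < 1) {k : ℤ} (hk : 0 < k) :
    ∫ t in Ioi 0, Real.exp (s * t) * erlang k t = (1 - s)⁻¹ ^ k := by
  obtain hk' | ⟨j, rfl⟩ := nonpos_or_exists_eq_natCast_add_one k
  · exact absurd hk hk'.not_gt
  · have hpos : 0 < 1 - s := sub_pos.mpr hs
    have hGamma := Real.integral_rpow_mul_exp_neg_mul_Ioi (a := j + 1) (by positivity) hpos
    have hterm : ∀ t : ℝ, Real.exp (s * t) * erlang (j + 1) t =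
        t ^ ((j + 1 : ℝ) - 1) * Real.exp (-((1 - s) * t)) / (j ! : ℝ) := fun t => by
      rw [erlang_natCast_add_one, add_sub_cancel_right, Real.rpow_natCast,
        show -((1 - s) * t) = s * t + -t by ring, Real.exp_add]
      ring
    simp only [hterm]
    rw [integral_div, hGamma, Real.Gamma_nat_eq_factorial, mul_div_cancel_right₀ _ (by positivity),
      one_div]
    exact_mod_cast Real.rpow_natCast (1 - s)⁻¹ (j + 1)

theorem integrableOn_exp_mul_erlang (hs : s < 1) {k : ℤ} (hk : 0 < k) :
    IntegrableOn (fun t => Real.exp (s * t) * erlang k t) (Ioi 0) := by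
  refine .of_integral_ne_zero ?_
  rw [integral_exp_mul_erlang hs hk]
  exact (zpow_pos (inv_pos.mpr (sub_pos.mpr hs)) k).ne'

theorem integrableOn_exp_mul_erlangDiff (hs : s < 1) (n : ℕ) {k : ℤ} (hk : 0 < k) :
    IntegrableOn (fun t => Real.exp (s * t) * erlangDiff n k t) (Ioi 0) := by
  induction n generalizing k with
  | zero => exact integrableOn_exp_mul_erlang hs hk
  | succ n ih =>
    simp only [erlangDiff_succ, mul_sub]
    exact (ih (by lia)).sub (ih hk)

theorem integral_exp_mul_erlangDiff (hs : s < 1) (n : ℕ) {k : ℤ} (hk : 0 < k) :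
    ∫ t in Ioi 0, Real.exp (s * t) * erlangDiff n k t = (1 - s)⁻¹ ^ k * (s / (1 - s)) ^ n := by
  induction n generalizing k with
  | zero => simpa only [erlangDiff_zero, pow_zero, mul_one] using integral_exp_mul_erlang hs hk
  | succ n ih =>
    have hne : 1 - s ≠ 0 := (sub_pos.mpr hs).ne'
    have hk₁ : 0 < k + 1 := by lia
    simp only [erlangDiff_succ, mul_sub]
    rw [integral_sub (integrableOn_exp_mul_erlangDiff hs n hk₁)
      (integrableOn_exp_mul_erlangDiff hs n hk), ih hk₁, ih hk, zpow_add_one₀ (inv_ne_zero hne)]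
    have hratio : (1 - s)⁻¹ - 1 = s / (1 - s) := by
      field_simp
      ring
    rw [pow_succ, ← hratio]
    ring

theorem integral_norm_exp_mul_erlangDiff_le (hs : s < 1) (n : ℕ) {k : ℤ} (hk : 0 < k) :
    ∫ t in Ioi 0, ‖Real.exp (s * t) * erlangDiff n k t‖ ≤
      (1 - s)⁻¹ ^ k * ((1 - s)⁻¹ + 1) ^ n := by
  induction n generalizing k with
  | zero =>
    rw [pow_zero, mul_one, ← integral_exp_mul_erlang hs hk]
    exact (setIntegral_congr_fun measurableSet_Ioi fun t ht =>
      Real.norm_of_nonneg (mul_nonneg (Real.exp_nonneg _) (erlang_nonneg k (le_of_lt ht)))).le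
  | succ n ih =>
    have hne : 1 - s ≠ 0 := (sub_pos.mpr hs).ne'
    have hk₁ : 0 < k + 1 := by lia
    have hsucc := integrableOn_exp_mul_erlangDiff hs n hk₁
    have hself := integrableOn_exp_mul_erlangDiff hs n hk
    simp only [erlangDiff_succ, mul_sub]
    calc ∫ t in Ioi 0, ‖Real.exp (s * t) * erlangDiff n (k + 1) t -
          Real.exp (s * t) * erlangDiff n k t‖
      _ ≤ ∫ t in Ioi 0, (‖Real.exp (s * t) * erlangDiff n (k + 1) t‖ +
          ‖Real.exp (s * t) * erlangDiff n k t‖) :=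
        integral_mono (hsucc.sub hself).norm (hsucc.norm.add hself.norm) fun t => norm_sub_le _ _
      _ ≤ (1 - s)⁻¹ ^ (k + 1) * ((1 - s)⁻¹ + 1) ^ n + (1 - s)⁻¹ ^ k * ((1 - s)⁻¹ + 1) ^ n := by
        rw [integral_add hsucc.norm hself.norm]
        exact add_le_add (ih hk₁) (ih hk)
      _ = (1 - s)⁻¹ ^ k * ((1 - s)⁻¹ + 1) ^ (n + 1) := by
        rw [zpow_add_one₀ (inv_ne_zero hne)]
        ring

theorem integrable_tsum_of_summable_integral_norm {α : Type*} [MeasurableSpace α] {μ : Measure α}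
    {F : ℕ → α → ℝ} (hmeas : AEStronglyMeasurable (fun x => ∑' n, F n x) μ)
    (hF : ∀ n, Integrable (F n) μ) (hsum : Summable fun n => ∫ x, ‖F n x‖ ∂μ) :
    Integrable (fun x => ∑' n, F n x) μ := by
  refine ⟨hmeas, ?_⟩
  calc ∫⁻ x, ‖∑' n, F n x‖ₑ ∂μ ≤ ∫⁻ x, ∑' n, ‖F n x‖ₑ ∂μ :=
        lintegral_mono fun x => enorm_tsum_le_tsum_enorm
    _ = ∑' n, ∫⁻ x, ‖F n x‖ₑ ∂μ := lintegral_tsum fun n => (hF n).1.enorm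
    _ = ∑' n, ENNReal.ofReal (∫ x, ‖F n x‖ ∂μ) :=
        tsum_congr fun n => (ofReal_integral_norm_eq_lintegral_enorm (hF n)).symm
    _ < ⊤ := hsum.tsum_ofReal_lt_top

variable {c : ℕ → ℝ}

theorem IsEntireSeq.summable_integral_norm_exp_mul_erlangDiff (hc : IsEntireSeq c) (hs : s < 1)
    {k : ℤ} (hk : 0 < k) :
    Summable fun n => ∫ t in Ioi 0, ‖c n * (Real.exp (s * t) * erlangDiff n k t)‖ := by
  have hbound : ∀ n, |∫ t in Ioi 0, ‖Real.exp (s * t) * erlangDiff n k t‖| ≤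
      (1 - s)⁻¹ ^ k * ((1 - s)⁻¹ + 1) ^ n := fun n => by
    rw [abs_of_nonneg (integral_nonneg fun t => norm_nonneg _)]
    exact integral_norm_exp_mul_erlangDiff_le hs n hk
  refine (hc.summable_mul hbound).abs.congr fun n => ?_
  rw [abs_mul, abs_of_nonneg (integral_nonneg fun t => norm_nonneg _), ← integral_const_mul]
  simp only [norm_mul (c n), Real.norm_eq_abs (c n)]

theorem exp_mul_erlangSeries (s : ℝ) (c : ℕ → ℝ) (k : ℤ) (t : ℝ) :
    Real.exp (s * t) * erlangSeries c k t =
      ∑' n, c n * (Real.exp (s * t) * erlangDiff n k t) := by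
  simp only [erlangSeries, ← tsum_mul_left, mul_left_comm]

theorem integrableOn_exp_mul_erlangSeries (hc : IsEntireSeq c) (hs : s < 1) {k : ℤ} (hk : 0 < k) :
    IntegrableOn (fun t => Real.exp (s * t) * erlangSeries c k t) (Ioi 0) := by
  have hcont : Continuous fun t => Real.exp (s * t) * erlangSeries c k t :=
    (by fun_prop : Continuous fun t : ℝ => Real.exp (s * t)).mul
      (contDiff_erlangSeries hc k).continuous
  have hmeas := hcont.aestronglyMeasurable (μ := volume.restrict (Ioi 0))
  simp only [exp_mul_erlangSeries] at hmeas ⊢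
  exact integrable_tsum_of_summable_integral_norm hmeas
    (fun n => (integrableOn_exp_mul_erlangDiff hs n hk).const_mul (c n))
    (hc.summable_integral_norm_exp_mul_erlangDiff hs hk)

theorem integral_exp_mul_erlangSeries (hc : IsEntireSeq c) (hs : s < 1) {k : ℤ} (hk : 0 < k) :
    ∫ t in Ioi 0, Real.exp (s * t) * erlangSeries c k t =
      (1 - s)⁻¹ ^ k * ∑' n, c n * (s / (1 - s)) ^ n := by
  simp only [exp_mul_erlangSeries]
  rw [← integral_tsum_of_summable_integral_norm
    (fun n => (integrableOn_exp_mul_erlangDiff hs n hk).const_mul (c n))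
    (hc.summable_integral_norm_exp_mul_erlangDiff hs hk), ← tsum_mul_left]
  refine tsum_congr fun n => ?_
  rw [integral_const_mul, integral_exp_mul_erlangDiff hs n hk, mul_left_comm]

variable {N NR : ℕ} {a : ℝ}

theorem integrableOn_exp_mul_snrPdf (hN : 1 ≤ N) (hNR : 1 ≤ NR) (a : ℝ) (hs : s < 1) :
    IntegrableOn (fun t => Real.exp (s * t) * snrPdf N NR t a) (Ioi 0) := by
  simp only [fun t => congrFun (snrPdf_eq_erlangSeries hN NR a) t]
  exact integrableOn_exp_mul_erlangSeries (isEntireSeq_coeffA N hNR a) hs (mod_cast hN)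

theorem integral_exp_mul_snrPdf (hN : 1 ≤ N) (hNR : 1 ≤ NR) (a : ℝ) (hs : s < 1) :
    ∫ t in Ioi 0, Real.exp (s * t) * snrPdf N NR t a = snrMgf N NR s a := by
  have hcoeff : ∀ n, coeffA N NR n a * (s / (1 - s)) ^ n = coeffA N NR n (a * s / (1 - s)) :=
    fun n => by
      rw [coeffA, coeffA, mul_div_assoc a, mul_pow]
      ring
  simp only [fun t => congrFun (snrPdf_eq_erlangSeries hN NR a) t]
  rw [integral_exp_mul_erlangSeries (isEntireSeq_coeffA N hNR a) hs (mod_cast hN), zpow_natCast,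
    inv_pow, ← one_div, snrMgf, hyp1F1, tsum_congr hcoeff]

theorem snrMgf_zero (N NR : ℕ) (a : ℝ) : snrMgf N NR 0 a = 1 := by
  rw [snrMgf, hyp1F1, tsum_eq_single 0 fun n hn => by simp [coeffA, hn]]
  simp [coeffA]

theorem integrable_snrMeasure_iff (hN : 1 ≤ N) (hNR : N ≤ NR) (ha : 0 ≤ a) {f : ℝ → ℝ} :
    Integrable f (snrMeasure N NR a) ↔ IntegrableOn (fun t => f t * snrPdf N NR t a) (Ioi 0) := by
  have hmeas : Measurable fun t => ENNReal.ofReal (snrPdf N NR t a) :=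
    (contDiff_snrPdf hN (hN.trans hNR) a).continuous.measurable.ennreal_ofReal
  rw [snrMeasure, integrable_withDensity_iff hmeas (.of_forall fun t => ENNReal.ofReal_lt_top)]
  refine integrableOn_congr_fun (fun t ht => ?_) measurableSet_Ioi
  rw [ENNReal.toReal_ofReal (snrPdf_nonneg hN hNR (le_of_lt ht) ha)]

theorem integral_snrMeasure (hN : 1 ≤ N) (hNR : N ≤ NR) (ha : 0 ≤ a) (f : ℝ → ℝ) :
    ∫ x, f x ∂snrMeasure N NR a = ∫ t in Ioi 0, f t * snrPdf N NR t a := by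
  have hmeas : Measurable fun t => ENNReal.ofReal (snrPdf N NR t a) :=
    (contDiff_snrPdf hN (hN.trans hNR) a).continuous.measurable.ennreal_ofReal
  rw [snrMeasure, integral_withDensity_eq_integral_toReal_smul hmeas
    (.of_forall fun t => ENNReal.ofReal_lt_top)]
  refine setIntegral_congr_fun measurableSet_Ioi fun t ht => ?_
  simp only [ENNReal.toReal_ofReal (snrPdf_nonneg hN hNR (le_of_lt ht) ha), smul_eq_mul, mul_comm]

theorem hasSnrMgf_snrMeasure (hN : 1 ≤ N) (hNR : N ≤ NR) (ha : 0 ≤ a) :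
    HasSnrMgf N NR a (snrMeasure N NR a) := by
  have hNR₁ := hN.trans hNR
  have hint : ∀ s < 1, Integrable (fun x => Real.exp (s * x)) (snrMeasure N NR a) := fun s hs =>
    (integrable_snrMeasure_iff hN hNR ha).mpr (integrableOn_exp_mul_snrPdf hN hNR₁ a hs)
  have hmgf : ∀ s < 1, ∫ x, Real.exp (s * x) ∂snrMeasure N NR a = snrMgf N NR s a := fun s hs =>
    (integral_snrMeasure hN hNR ha _).trans (integral_exp_mul_snrPdf hN hNR₁ a hs)
  refine ⟨?_, fun s hs => ⟨hint s hs, hmgf s hs⟩⟩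
  have hone := hint 0 one_pos
  have hmass := hmgf 0 one_pos
  simp only [zero_mul, Real.exp_zero, snrMgf_zero, integral_const, smul_eq_mul, mul_one]
    at hone hmass
  have : IsFiniteMeasure (snrMeasure N NR a) :=
    (integrable_const_iff.mp hone).resolve_left one_ne_zero
  exact isProbabilityMeasure_iff_real.mpr hmass

theorem eqOn_complexMGF_of_eqOn_mgf {Ω Ω' : Type*} {mΩ : MeasurableSpace Ω}
    {mΩ' : MeasurableSpace Ω'} {μ : Measure Ω} {ν : Measure Ω'} {X : Ω → ℝ} {Y : Ω' → ℝ} {U : Set ℝ}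
    (hUo : IsOpen U) (hUc : Convex ℝ U) (hX : U ⊆ integrableExpSet X μ)
    (hY : U ⊆ integrableExpSet Y ν) (h : EqOn (mgf X μ) (mgf Y ν) U) :
    EqOn (complexMGF X μ) (complexMGF Y ν) (Complex.re ⁻¹' U) := by
  intro z hz
  have hfreq : ∃ᶠ w in nhdsWithin (z.re : ℂ) {(z.re : ℂ)}ᶜ,
      complexMGF X μ w = complexMGF Y ν w := by
    have hreal : ∀ᶠ x : ℝ in nhdsWithin z.re {z.re}ᶜ, complexMGF X μ x = complexMGF Y ν x := by
      filter_upwards [mem_nhdsWithin_of_mem_nhds (hUo.mem_nhds hz)] with x hx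
      rw [complexMGF_ofReal, complexMGF_ofReal, h hx]
    refine Filter.Tendsto.frequently ?_ hreal.frequently
    exact Complex.continuous_ofReal.continuousWithinAt.tendsto_nhdsWithin
      fun x hx => Complex.ofReal_injective.ne hx
  have hanX : AnalyticOnNhd ℂ (complexMGF X μ) (Complex.re ⁻¹' U) :=
    analyticOnNhd_complexMGF.mono fun w hw => interior_maximal hX hUo hw
  have hanY : AnalyticOnNhd ℂ (complexMGF Y ν) (Complex.re ⁻¹' U) :=
    analyticOnNhd_complexMGF.mono fun w hw => interior_maximal hY hUo hw
  exact hanX.eqOn_of_preconnected_of_frequently_eq hanY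
    (hUc.linear_preimage Complex.reLm).isPreconnected (z₀ := (z.re : ℂ)) hz hfreq hz

theorem ext_of_eqOn_mgf {μ ν : Measure ℝ} [IsFiniteMeasure μ] [IsFiniteMeasure ν] {U : Set ℝ}
    (hUo : IsOpen U) (hUc : Convex ℝ U) (hU₀ : 0 ∈ U) (hμ : U ⊆ integrableExpSet id μ)
    (hν : U ⊆ integrableExpSet id ν) (h : EqOn (mgf id μ) (mgf id ν) U) : μ = ν := by
  refine Measure.ext_of_charFun (funext fun t => ?_)
  rw [← complexMGF_id_mul_I, ← complexMGF_id_mul_I]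
  exact eqOn_complexMGF_of_eqOn_mgf hUo hUc hμ hν h (by simpa using hU₀)

theorem hasSnrMgf_iff (hN : 1 ≤ N) (hNR : N ≤ NR) (ha : 0 ≤ a) (ν : Measure ℝ) :
    HasSnrMgf N NR a ν ↔ ν = snrMeasure N NR a := by
  have hsnr := hasSnrMgf_snrMeasure hN hNR ha
  refine ⟨fun hν => ?_, fun hν => hν ▸ hsnr⟩
  have := hν.1
  have := hsnr.1
  exact ext_of_eqOn_mgf isOpen_Iio (convex_Iio 1) (mem_Iio.mpr one_pos) (fun s hs => (hν.2 s hs).1)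
    (fun s hs => (hsnr.2 s hs).1) fun s hs => (hν.2 s hs).2.trans (hsnr.2 s hs).2.symm

end Law

end ZFSnr

end

theorem mainTheorem5_general (N NR : ℕ) (hN : 1 ≤ N) (hNR : 1 ≤ NR) :
    (N ≤ NR → ∀ a : ℝ, 0 ≤ a →
      (∀ t : ℝ, 0 ≤ t → 0 ≤ ZFSnr.snrPdf N NR t a) ∧
      ∀ ν : Measure ℝ, ZFSnr.HasSnrMgf N NR a ν ↔ ν = ZFSnr.snrMeasure N NR a) ∧
    (∀ a : ℝ, ContDiff ℝ ∞ fun t => ZFSnr.snrPdf N NR t a) ∧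
    ∀ t a : ℝ, t ≠ 0 → a ≠ 0 →
      HasDerivAt (fun b => ZFSnr.snrVec N NR t b)
        ((1 / a) • (ZFSnr.matQ N NR t a *ᵥ ZFSnr.snrVec N NR t a)) a ∧
      a * deriv (fun b => ZFSnr.snrPdf N NR t b) a =
        -ZFSnr.snrPdf N NR t a + ((N : ℝ) - t - 2) * ZFSnr.snrPdfDeriv N NR 1 t a
          - t * ZFSnr.snrPdfDeriv N NR 2 t a ∧
      a * deriv (fun b => ZFSnr.snrPdfDeriv N NR 1 t b) a =
        -t * ZFSnr.snrPdfDeriv N NR 3 t a + ((N : ℝ) - t - 3) * ZFSnr.snrPdfDeriv N NR 2 t a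
          - 2 * ZFSnr.snrPdfDeriv N NR 1 t a := by
  refine ⟨fun hle a ha => ⟨fun t ht => ZFSnr.snrPdf_nonneg hN hle ht ha,
    ZFSnr.hasSnrMgf_iff hN hle ha⟩, ZFSnr.contDiff_snrPdf hN hNR,
    fun t a ht ha => ⟨ZFSnr.hasDerivAt_snrVec hN hNR ht ha, ?_, ?_⟩⟩
  · have h := ZFSnr.mul_deriv_snrPdfDeriv hN hNR ha 0 t
    have hzero : ∀ b, ZFSnr.snrPdfDeriv N NR 0 t b = ZFSnr.snrPdf N NR t b := fun b =>
      congrFun iteratedDeriv_zero t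
    simp only [hzero, Nat.cast_zero] at h
    linear_combination h
  · have h := ZFSnr.mul_deriv_snrPdfDeriv hN hNR ha 1 t
    push_cast at h
    linear_combination h

theorem mainTheorem5 (N NR : ℕ) (hN : 1 ≤ N) (hNR : N ≤ NR) :
    -- `p(·, a)` is the density of the law whose moment generating function is `M(·, a)`
    (∀ a : ℝ, 0 ≤ a →
      (∀ t : ℝ, 0 < t → 0 ≤ ZFSnr.snrPdf N NR t a) ∧
      ∀ ν : Measure ℝ, ZFSnr.HasSnrMgf N NR a ν ↔ ν = ZFSnr.snrMeasure N NR a) ∧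
    -- `p(·, a)` is smooth on `(0, ∞)`
    (∀ a : ℝ, 0 ≤ a → ContDiffOn ℝ ∞ (fun t => ZFSnr.snrPdf N NR t a) (Ioi 0)) ∧
    -- the differential system with respect to `a`
    ∀ t a : ℝ, 0 < t → 0 < a →
      HasDerivAt (fun b => ZFSnr.snrVec N NR t b)
        ((1 / a) • (ZFSnr.matQ N NR t a *ᵥ ZFSnr.snrVec N NR t a)) a ∧
      a * deriv (fun b => ZFSnr.snrPdf N NR t b) a =
        -ZFSnr.snrPdf N NR t a + ((N : ℝ) - t - 2) * ZFSnr.snrPdfDeriv N NR 1 t a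
          - t * ZFSnr.snrPdfDeriv N NR 2 t a ∧
      a * deriv (fun b => ZFSnr.snrPdfDeriv N NR 1 t b) a =
        -t * ZFSnr.snrPdfDeriv N NR 3 t a + ((N : ℝ) - t - 3) * ZFSnr.snrPdfDeriv N NR 2 t a
          - 2 * ZFSnr.snrPdfDeriv N NR 1 t a := by
  obtain ⟨hlaw, hsmooth, hsystem⟩ := mainTheorem5_general N NR hN (hN.trans hNR)
  exact ⟨fun a ha => ⟨fun t ht => (hlaw hNR a ha).1 t ht.le, (hlaw hNR a ha).2⟩,
    fun a _ => (hsmooth a).contDiffOn, fun t a ht ha => hsystem t a ht.ne' ha.ne'⟩
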